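/- Online $b$-matching with stochastic rewards. Fix an integer $b\ge 1$. A finite set $S$ of servers, each of capacity $b$, is known in advance. Requests arrive one by one; on arrival, the set of servers adjacent to the request and the success probabilities $p_{s,r}\in[0,1]$ of its edges are revealed. The algorithm immediately and irrevocably assigns the request to an adjacent server that has so far been matched fewer than $b$ times, or leaves it unassigned. An assignment of $r$ to $s$ becomes a match with probability $p_{s,r}$, independently of the past, and the algorithm learns the outcome only afterwards; an unsuccessful assignment uses no capacity. The decisions of a randomized online algorithm $\mathrm{Alg}$ depend only on its random seed, on the servers and $b$, and on the requests and outcomes seen so far. Let $\mathbb{E}[\mathrm{Alg}(G)]$ be its expected number of matches on the input graph $G$ (with its arrival order). Let $\mathrm{SOpt}(G)$, the stochastic (clairvoyant) benchmark, be the largest expected number of matches on $G$ of an algorithm that knows $G$ and all edge probabilities in advance, but serves the requests in their order of arrival and learns the outcome of an assignment only after making it. **Theorem.** For every $b\ge 1$, no randomized online algorithm has a competitive ratio greater than $1-1/e$ against $\mathrm{SOpt}$, even for equal and vanishing edge probabilities. Precisely: for every integer $b\ge1$ and every real $c>1-1/e$ there are $n\in\mathbb{N}$ and $p_0>0$ such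 that, for every $p\in(0,1]$ with $p\le p_0$ and every randomized online algorithm $\mathrm{Alg}$ (which may be designed for $n$, $b$ and $p$), there is an input graph $G$ with $n$ servers, all of whose edges have success probability $p$, such that $$\mathbb{E}[\mathrm{Alg}(G)] < c\cdot \mathrm{SOpt}(G).$$ -/

import Mathlib

open MeasureTheory
open scoped ENNReal

universe u

namespace StochasticBMatching

/-- A request, described by what is revealed on its arrival: `r s = none` if the request is not
adjacent to the server `s`, and `r s = some p` if there is an edge to `s` with success
probability `p`. -/
abbrev Request (S : Type) : Type := S → Option unitInterval

/-- An input graph on the server set `S`: the requests in their order of arrival. -/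
abbrev Instance (S : Type) : Type := List (Request S)

/-- What an algorithm has seen of one processed request: the request and the assignment, which is
`none` if the request stayed unassigned, `some (s, true)` if it was assigned to `s` and accepted
(a match), and `some (s, false)` if it was assigned to `s` and did not accept. -/
structure Step (S : Type) where
  request : Request S
  assignment : Option (S × Bool)

/-- The processed requests, most recent one first. -/
abbrev History (S : Type) : Type := List (Step S)

open Classical in
/-- The number of (successful) matches of the server `s`. -/
noncomputable def matchesOf {S : Type} (h : History S) (s : S) : ℕ :=
  h.countP fun st => decide (st.assignment = some (s, true))

/-- The total number of matches. -/
noncomputable def totalMatches {S : Type} [Fintype S] (h : History S) : ℕ :=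
  ∑ s, matchesOf h s

/-- A deterministic decision rule for servers of capacity `b`. Given the history and the arriving
request it either leaves the request unassigned or assigns it to an adjacent server with remaining
capacity. The outcome of an assignment is only known afterwards, as a part of the history. -/
structure Policy (S : Type) (b : ℕ) where
  choose : History S → Request S → Option S
  feasible : ∀ h r s, choose h r = some s → r s ≠ none ∧ matchesOf h s < b

/-- A biased coin: `true` with probability `p` and `false` with probability `1 - p`. -/
noncomputable def coin (p : unitInterval) : PMF Bool :=
  PMF.ofFintype
    (fun ok => if ok then ENNReal.ofReal (p : ℝ) else ENNReal.ofReal (1 - (p : ℝ))) (by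
      rw [Fintype.sum_bool, if_pos rfl, if_neg Bool.false_ne_true,
        ← ENNReal.ofReal_add p.2.1 (sub_nonneg.2 p.2.2), add_sub_cancel, ENNReal.ofReal_one])

/-- The law of the final history when the policy starts with history `h` and then serves the given
requests in their order. Every assignment succeeds with the probability of its edge, independently
of the past. -/
noncomputable def Policy.run {S : Type} {b : ℕ} (A : Policy S b) :
    History S → Instance S → PMF (History S)
  | h, [] => PMF.pure h
  | h, r :: rs =>
    match A.choose h r with
    | none => A.run (⟨r, none⟩ :: h) rs
    | some s =>
      (coin ((r s).getD 0)).bind fun ok => A.run (⟨r, some (s, ok)⟩ :: h) rs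

/-- The expected number of matches of a policy on `G`. -/
noncomputable def Policy.expectedMatches {S : Type} [Fintype S] {b : ℕ} (A : Policy S b)
    (G : Instance S) : ℝ≥0∞ :=
  ∑' h, A.run [] G h * (totalMatches h : ℝ≥0∞)

/-- The stochastic (clairvoyant) benchmark: the largest expected number of matches on `G` of a
policy. The graph `G` is fixed before the policy is picked, so the policy may depend on all of `G`,
but it serves the requests in their order of arrival and learns the outcome of an assignment only
after making it. -/
noncomputable def SOpt {S : Type} [Fintype S] (b : ℕ) (G : Instance S) : ℝ≥0∞ :=
  ⨆ A : Policy S b, A.expectedMatches G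

/-- A randomized online algorithm for the server set `S` and capacity `b`: a policy that depends
on a random seed, drawn from an arbitrary probability space. It decides on a request from the seed,
the servers, the capacity, the requests so far and their outcomes only. -/
structure RandomizedAlgorithm (S : Type) (b : ℕ) where
  Ω : Type u
  [measurableSpace : MeasurableSpace Ω]
  μ : Measure Ω
  [isProbabilityMeasure : IsProbabilityMeasure μ]
  policy : Ω → Policy S b
  measurable_choose : ∀ h r d, MeasurableSet {ω | (policy ω).choose h r = d}

/-- The expected number of matches, over the seed and the outcomes of the assignments. -/
noncomputable def RandomizedAlgorithm.expectedMatches {S : Type} [Fintype S] {b : ℕ}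
    (A : RandomizedAlgorithm.{u} S b) (G : Instance S) : ℝ≥0∞ :=
  letI := A.measurableSpace
  ∫⁻ ω, (A.policy ω).expectedMatches G ∂A.μ

/-- `A` is `c`-competitive against the stochastic benchmark on the class `𝒢` of input graphs. -/
def RandomizedAlgorithm.IsCompetitiveOn {S : Type} [Fintype S] {b : ℕ}
    (A : RandomizedAlgorithm.{u} S b) (c : ℝ) (𝒢 : Set (Instance S)) : Prop :=
  ∀ G ∈ 𝒢, ENNReal.ofReal c * SOpt b G ≤ A.expectedMatches G

/-- The input graphs on `S` all of whose edges have success probability `p`. -/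
def equalProbability (S : Type) (p : unitInterval) : Set (Instance S) :=
  {G | ∀ r ∈ G, ∀ s q, r s = some q → q = p}

end StochasticBMatching

/-! The servers are split into `k` groups of joint capacity `M`. The adversary proceeds in phases:
in each phase, about `M / p` equal requests arrive that are adjacent to all groups not yet
dropped, and then it drops the group with the smallest mean load. A dropped group gets no further
requests, so capacity that an online algorithm left unused there is lost. Stopping the count of
losses when `s` groups remain, the expected number of matches is at most `M * (k - s * (H_k -
H_s))`, which for `s ≈ k / e` is about `(1 - 1 / e) * k * M`.

A clairvoyant policy serves in each phase the group that is about to be dropped. Its number of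
matches there is binomial with mean about `M`, truncated at `M`, and thus has mean `M - O(√M)`.
-/

namespace StochasticBMatching

section Load

variable {S : Type}

@[simp]
theorem matchesOf_nil (s : S) : matchesOf [] s = 0 := rfl

@[simp]
theorem matchesOf_cons_none (r : Request S) (h : History S) (s : S) :
    matchesOf (⟨r, none⟩ :: h) s = matchesOf h s := by
  simp [matchesOf]

@[simp]
theorem matchesOf_cons_false (r : Request S) (h : History S) (s s' : S) :
    matchesOf (⟨r, some (s', false)⟩ :: h) s = matchesOf h s := by
  simp [matchesOf]

@[simp]
theorem matchesOf_cons_true [DecidableEq S] (r : Request S) (h : History S) (s s' : S) :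
    matchesOf (⟨r, some (s', true)⟩ :: h) s = matchesOf h s + if s' = s then 1 else 0 := by
  simp [matchesOf, List.countP_cons]

theorem matchesOf_le_matchesOf_cons (st : Step S) (h : History S) (s : S) :
    matchesOf h s ≤ matchesOf (st :: h) s :=
  (List.sublist_cons_self st h).countP_le

/-- The number of matches of the servers in `W`, that is, the part of their joint capacity
`W.card * b` that is used up. -/
noncomputable def load (W : Finset S) (h : History S) : ℕ := ∑ s ∈ W, matchesOf h s

variable (W : Finset S)

@[simp]
theorem load_nil : load W [] = 0 := by simp [load]

@[simp]
theorem load_cons_none (r : Request S) (h : History S) :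
    load W (⟨r, none⟩ :: h) = load W h := by
  simp [load]

@[simp]
theorem load_cons_false (r : Request S) (h : History S) (s : S) :
    load W (⟨r, some (s, false)⟩ :: h) = load W h := by
  simp [load]

@[simp]
theorem load_cons_true [DecidableEq S] (r : Request S) (h : History S) (s : S) :
    load W (⟨r, some (s, true)⟩ :: h) = load W h + if s ∈ W then 1 else 0 := by
  simp [load, Finset.sum_add_distrib]

theorem load_le_load_cons (st : Step S) (h : History S) : load W h ≤ load W (st :: h) :=
  Finset.sum_le_sum fun s _ => matchesOf_le_matchesOf_cons st h s

variable {W}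

theorem load_cons_some_of_notMem {s : S} (hs : s ∉ W) (r : Request S) (ok : Bool)
    (h : History S) : load W (⟨r, some (s, ok)⟩ :: h) = load W h := by
  classical
  cases ok <;> simp [hs]

theorem exists_matchesOf_lt_of_load_lt {b : ℕ} {h : History S} (hW : load W h < W.card * b) :
    ∃ s ∈ W, matchesOf h s < b :=
  Finset.exists_lt_of_sum_lt (by simpa [load] using hW)

end Load

section Expectation

theorem tsum_bind_apply_mul {α β : Type*} (q : PMF α) (f : α → PMF β) (F : β → ℝ≥0∞) :
    ∑' y, q.bind f y * F y = ∑' x, q x * ∑' y, f x y * F y := by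
  simp_rw [PMF.bind_apply, ← ENNReal.tsum_mul_right, ← ENNReal.tsum_mul_left, mul_assoc]
  exact ENNReal.tsum_comm

theorem ofReal_add_ofReal_one_sub (p : unitInterval) :
    ENNReal.ofReal p + ENNReal.ofReal (1 - p) = 1 := by
  rw [← ENNReal.ofReal_add p.2.1 (sub_nonneg.2 p.2.2), add_sub_cancel, ENNReal.ofReal_one]

variable {S : Type} {b : ℕ} (A : Policy S b)

theorem Policy.run_append (h : History S) (G₁ G₂ : Instance S) :
    A.run h (G₁ ++ G₂) = (A.run h G₁).bind fun h' => A.run h' G₂ := by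
  induction G₁ generalizing h with
  | nil => simp [run]
  | cons r G₁ ih => cases hc : A.choose h r <;> simp [run, hc, ih, PMF.bind_bind]

theorem Policy.forall_mem_support_run {P : History S → Prop} {G : Instance S}
    (hstep : ∀ h, P h → ∀ r ∈ G, ∀ a, a.map Prod.fst = A.choose h r → P (⟨r, a⟩ :: h))
    {h : History S} (hh : P h) : ∀ h' ∈ (A.run h G).support, P h' := by
  induction G generalizing h with
  | nil => simpa [run] using hh
  | cons r G ih =>
    have ih' {h} := @ih (fun h hh r' hr' => hstep h hh r' (List.mem_cons_of_mem r hr')) h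
    have hstep' := hstep h hh r List.mem_cons_self
    intro h' hh'
    cases hc : A.choose h r with
    | none => exact ih' (hstep' none hc.symm) h' (by simpa [run, hc] using hh')
    | some s =>
      simp only [run, hc, PMF.mem_support_bind_iff] at hh'
      obtain ⟨ok, -, hok⟩ := hh'
      exact ih' (hstep' (some (s, ok)) hc.symm) h' hok

theorem Policy.matchesOf_le_of_mem_support_run {G : Instance S} {h : History S} {s : S}
    (hs : matchesOf h s ≤ b) : ∀ h' ∈ (A.run h G).support, matchesOf h' s ≤ b := by
  classical
  refine A.forall_mem_support_run (P := fun h => matchesOf h s ≤ b) ?_ hs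
  rintro h hs r - (_ | ⟨s', _ | _⟩) ha
  · simpa using hs
  · simpa using hs
  · have hlt := (A.feasible h r s' ha.symm).2
    rw [matchesOf_cons_true]
    split_ifs with hss'
    · exact hss' ▸ hlt
    · simpa using hs

theorem Policy.load_le_of_mem_support_run (W : Finset S) {G : Instance S} {h : History S} :
    ∀ h' ∈ (A.run h G).support, load W h ≤ load W h' :=
  A.forall_mem_support_run (P := (load W h ≤ load W ·))
    (fun h' hh' r _ a _ => hh'.trans (load_le_load_cons W ⟨r, a⟩ h')) le_rfl

theorem Policy.load_eq_of_mem_support_run {W : Finset S} {G : Instance S}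
    (hG : ∀ r ∈ G, ∀ s ∈ W, r s = none) {h : History S} :
    ∀ h' ∈ (A.run h G).support, load W h' = load W h := by
  refine A.forall_mem_support_run (P := (load W · = load W h)) ?_ rfl
  rintro h' hh' r hr (_ | ⟨s, ok⟩) ha
  · simpa using hh'
  · have hs : s ∉ W := fun hs => (A.feasible h' r s ha.symm).1 (hG r hr s hs)
    rw [load_cons_some_of_notMem hs, hh']

/-- The expectation of `F` at the final history when the policy starts with history `h` and then
serves the requests in `G`. -/
noncomputable def Policy.expectation (F : History S → ℝ≥0∞) (h : History S) (G : Instance S) :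
    ℝ≥0∞ :=
  ∑' h', A.run h G h' * F h'

theorem Policy.expectation_nil (F : History S → ℝ≥0∞) (h : History S) :
    A.expectation F h [] = F h := by
  rw [expectation, tsum_eq_single h fun h' hh' => by simp [run, PMF.pure_apply, hh']]
  simp [run]

theorem Policy.expectation_cons_of_choose_eq_none (F : History S → ℝ≥0∞) {h : History S}
    {r : Request S} (hc : A.choose h r = none) (G : Instance S) :
    A.expectation F h (r :: G) = A.expectation F (⟨r, none⟩ :: h) G := by
  simp [expectation, run, hc]

theorem Policy.expectation_cons_of_choose_eq_some (F : History S → ℝ≥0∞) {h : History S}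
    {r : Request S} {s : S} {p : unitInterval} (hc : A.choose h r = some s) (hp : r s = some p)
    (G : Instance S) :
    A.expectation F h (r :: G) =
      ENNReal.ofReal p * A.expectation F (⟨r, some (s, true)⟩ :: h) G +
        ENNReal.ofReal (1 - p) * A.expectation F (⟨r, some (s, false)⟩ :: h) G := by
  simp only [expectation, run, hc, tsum_bind_apply_mul, tsum_bool, hp]
  simp [coin, add_comm]

theorem Policy.expectation_append (F : History S → ℝ≥0∞) (h : History S) (G₁ G₂ : Instance S) :
    A.expectation F h (G₁ ++ G₂) = A.expectation (A.expectation F · G₂) h G₁ := by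
  simp only [expectation, run_append, tsum_bind_apply_mul]

theorem Policy.expectation_const (x : ℝ≥0∞) (h : History S) (G : Instance S) :
    A.expectation (fun _ => x) h G = x := by
  rw [expectation, ENNReal.tsum_mul_right, PMF.tsum_coe, one_mul]

theorem Policy.expectation_mono {F F' : History S → ℝ≥0∞} {h : History S} {G : Instance S}
    (hF : ∀ h' ∈ (A.run h G).support, F h' ≤ F' h') :
    A.expectation F h G ≤ A.expectation F' h G := by
  refine ENNReal.tsum_le_tsum fun h' => ?_
  by_cases hh' : h' ∈ (A.run h G).support
  · gcongr
    exact hF h' hh'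
  · simp [(PMF.apply_eq_zero_iff _ _).2 hh']

theorem Policy.le_expectation {F : History S → ℝ≥0∞} {h : History S} {G : Instance S} {x : ℝ≥0∞}
    (hF : ∀ h' ∈ (A.run h G).support, x ≤ F h') : x ≤ A.expectation F h G :=
  (A.expectation_const x h G).ge.trans (A.expectation_mono hF)

theorem Policy.expectation_le {F : History S → ℝ≥0∞} {h : History S} {G : Instance S} {x : ℝ≥0∞}
    (hF : ∀ h' ∈ (A.run h G).support, F h' ≤ x) : A.expectation F h G ≤ x :=
  (A.expectation_mono hF).trans (A.expectation_const x h G).le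

theorem Policy.expectation_sum {ι : Type*} (t : Finset ι) (F : ι → History S → ℝ≥0∞)
    (h : History S) (G : Instance S) :
    A.expectation (fun h' => ∑ i ∈ t, F i h') h G = ∑ i ∈ t, A.expectation (F i) h G := by
  simp only [expectation, Finset.mul_sum]
  exact Summable.tsum_finsetSum fun _ _ => ENNReal.summable

theorem Policy.expectation_load_of_not_adjacent {W : Finset S} {G : Instance S}
    (hG : ∀ r ∈ G, ∀ s ∈ W, r s = none) (h : History S) :
    A.expectation (fun h' => load W h') h G = load W h :=
  le_antisymm
    (A.expectation_le fun h' hh' => by rw [A.load_eq_of_mem_support_run hG h' hh'])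
    (A.le_expectation fun h' hh' => by rw [A.load_eq_of_mem_support_run hG h' hh'])

theorem Policy.expectation_load_le_card_mul (W : Finset S) (G : Instance S) :
    A.expectation (fun h => load W h) [] G ≤ W.card * b := by
  refine A.expectation_le fun h hh => ?_
  have hload : load W h ≤ W.card • b :=
    Finset.sum_le_card_nsmul _ _ _ fun s _ => A.matchesOf_le_of_mem_support_run (by simp) h hh
  exact_mod_cast hload

theorem Policy.expectation_load_le_add_length_mul (W : Finset S) {p : unitInterval}
    {G : Instance S} (hG : G ∈ equalProbability S p) (h : History S) :
    A.expectation (fun h' => load W h') h G ≤ load W h + G.length * ENNReal.ofReal p := by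
  classical
  induction G generalizing h with
  | nil => simp [expectation_nil]
  | cons r G ih =>
    have ih' := ih fun r' hr' => hG r' (List.mem_cons_of_mem r hr')
    rw [List.length_cons]
    cases hc : A.choose h r with
    | none =>
      rw [A.expectation_cons_of_choose_eq_none _ hc]
      refine (ih' _).trans ?_
      rw [load_cons_none]
      gcongr
      exact Nat.le_succ _
    | some s =>
      obtain ⟨q, hq⟩ := Option.ne_none_iff_exists'.1 (A.feasible h r s hc).1
      obtain rfl := hG r List.mem_cons_self s q hq
      have hmatch : (load W (⟨r, some (s, true)⟩ :: h) : ℝ≥0∞) ≤ load W h + 1 := by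
        rw [load_cons_true]
        split_ifs <;> simp
      rw [A.expectation_cons_of_choose_eq_some _ hc hq]
      calc
        _ ≤ ENNReal.ofReal q * (load W h + 1 + G.length * ENNReal.ofReal q) +
            ENNReal.ofReal (1 - q) * (load W h + G.length * ENNReal.ofReal q) := by
          gcongr
          · exact (ih' _).trans (by gcongr)
          · simpa using ih' (⟨r, some (s, false)⟩ :: h)
        _ = (ENNReal.ofReal q + ENNReal.ofReal (1 - q)) *
              (load W h + G.length * ENNReal.ofReal q) + ENNReal.ofReal q := by ring
        _ = load W h + (G.length + 1 : ℕ) * ENNReal.ofReal q := by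
          rw [ofReal_add_ofReal_one_sub]
          push_cast
          ring

end Expectation

section MeanLoad

variable {S : Type} {b : ℕ}

theorem measurable_expectation [Countable S] {Ω : Type*} [MeasurableSpace Ω]
    {P : Ω → Policy S b} (hP : ∀ h r d, MeasurableSet {ω | (P ω).choose h r = d})
    (F : History S → ℝ≥0∞) (h : History S) (G : Instance S) :
    Measurable fun ω => (P ω).expectation F h G := by
  induction G generalizing h with
  | nil => simp only [Policy.expectation_nil, measurable_const]
  | cons r G ih =>
    let : MeasurableSpace (Option S) := ⊤
    have hchoose : Measurable fun ω => (P ω).choose h r := measurable_to_countable' (hP h r)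
    let V : Option S × Ω → ℝ≥0∞ := fun
      | (none, ω) => (P ω).expectation F (⟨r, none⟩ :: h) G
      | (some s, ω) => ∑' ok, coin ((r s).getD 0) ok *
          (P ω).expectation F (⟨r, some (s, ok)⟩ :: h) G
    have hV : Measurable V := by
      refine measurable_from_prod_countable_right fun
        | none => ih _
        | some s => Measurable.tsum fun ok => (ih _).const_mul _
    have hVeq : (fun ω => (P ω).expectation F h (r :: G)) = fun ω => V ((P ω).choose h r, ω) := by
      funext ω
      cases hc : (P ω).choose h r <;>
        simp only [V, Policy.expectation, Policy.run, hc, tsum_bind_apply_mul]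
    rw [hVeq]
    exact hV.comp (hchoose.prodMk measurable_id)

namespace RandomizedAlgorithm

variable (A : RandomizedAlgorithm.{u} S b)

/-- The expected number of matches of the servers in `W`, as a real number: it is at most
`W.card * b`. -/
noncomputable def meanLoad (W : Finset S) (G : Instance S) : ℝ :=
  letI := A.measurableSpace
  (∫⁻ ω, (A.policy ω).expectation (fun h => load W h) [] G ∂A.μ).toReal

theorem meanLoad_nonneg (W : Finset S) (G : Instance S) : 0 ≤ A.meanLoad W G :=
  ENNReal.toReal_nonneg

theorem lintegral_expectation_load_le {W : Finset S} {G : Instance S} {x : ℝ≥0∞}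
    (hx : ∀ ω, (A.policy ω).expectation (fun h => load W h) [] G ≤ x) :
    letI := A.measurableSpace
    ∫⁻ ω, (A.policy ω).expectation (fun h => load W h) [] G ∂A.μ ≤ x := by
  let := A.measurableSpace
  have := A.isProbabilityMeasure
  exact (lintegral_mono hx).trans (by simp)

theorem lintegral_expectation_load_ne_top (W : Finset S) (G : Instance S) :
    letI := A.measurableSpace
    ∫⁻ ω, (A.policy ω).expectation (fun h => load W h) [] G ∂A.μ ≠ ∞ :=
  ne_top_of_le_ne_top (by finiteness)
    (A.lintegral_expectation_load_le fun ω => (A.policy ω).expectation_load_le_card_mul W G)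

theorem ofReal_meanLoad_univ [Fintype S] (G : Instance S) :
    ENNReal.ofReal (A.meanLoad Finset.univ G) = A.expectedMatches G :=
  ENNReal.ofReal_toReal (A.lintegral_expectation_load_ne_top Finset.univ G)

theorem meanLoad_le_card_mul (W : Finset S) (G : Instance S) :
    A.meanLoad W G ≤ W.card * b :=
  ENNReal.toReal_le_of_le_ofReal (by positivity) <| A.lintegral_expectation_load_le fun ω => by
    simpa [ENNReal.ofReal_mul] using (A.policy ω).expectation_load_le_card_mul W G

theorem meanLoad_le_length_mul (W : Finset S) {p : unitInterval} {G : Instance S}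
    (hG : G ∈ equalProbability S p) : A.meanLoad W G ≤ G.length * p :=
  ENNReal.toReal_le_of_le_ofReal (mul_nonneg (Nat.cast_nonneg _) p.2.1) <|
    A.lintegral_expectation_load_le fun ω => by
      simpa [ENNReal.ofReal_mul] using
        (A.policy ω).expectation_load_le_add_length_mul W hG []

theorem meanLoad_append_of_not_adjacent {W : Finset S} (G₁ : Instance S) {G₂ : Instance S}
    (hG : ∀ r ∈ G₂, ∀ s ∈ W, r s = none) : A.meanLoad W (G₁ ++ G₂) = A.meanLoad W G₁ := by
  simp only [meanLoad, Policy.expectation_append, Policy.expectation_load_of_not_adjacent _ hG]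

theorem sum_meanLoad_of_sum_load [Countable S] {ι : Type*} {t : Finset ι} {W : ι → Finset S}
    {V : Finset S} (hV : ∀ h, ∑ i ∈ t, load (W i) h = load V h) (G : Instance S) :
    ∑ i ∈ t, A.meanLoad (W i) G = A.meanLoad V G := by
  let := A.measurableSpace
  simp only [meanLoad, ← hV, Nat.cast_sum, Policy.expectation_sum]
  rw [lintegral_finsetSum _ fun i _ => measurable_expectation A.measurable_choose _ [] G,
    ENNReal.toReal_sum fun i _ => A.lintegral_expectation_load_ne_top (W i) G]

end RandomizedAlgorithm

end MeanLoad

section TruncatedMean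

/-- The expectation of `min (x + B) M` for a binomial variable `B` with `n` trials of success
probability `p`, computed by conditioning on the first trial. -/
noncomputable def truncatedMean (M p : ℝ) : ℕ → ℕ → ℝ
  | 0, x => min x M
  | n + 1, x => p * truncatedMean M p n (x + 1) + (1 - p) * truncatedMean M p n x

variable {M p : ℝ}

theorem truncatedMean_le (hp : 0 ≤ p) (hp' : p ≤ 1) (n x : ℕ) : truncatedMean M p n x ≤ M := by
  induction n generalizing x with
  | zero => exact min_le_right _ _
  | succ n ih =>
    calc truncatedMean M p (n + 1) x ≤ p * M + (1 - p) * M :=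
          add_le_add (mul_le_mul_of_nonneg_left (ih _) hp)
            (mul_le_mul_of_nonneg_left (ih _) (sub_nonneg.2 hp'))
      _ = M := by ring

theorem truncatedMean_nonneg (hM : 0 ≤ M) (hp : 0 ≤ p) (hp' : p ≤ 1) (n x : ℕ) :
    0 ≤ truncatedMean M p n x := by
  induction n generalizing x with
  | zero => exact le_min (Nat.cast_nonneg x) hM
  | succ n ih => exact add_nonneg (mul_nonneg hp (ih _)) (mul_nonneg (sub_nonneg.2 hp') (ih _))

theorem truncatedMean_monotone (hp : 0 ≤ p) (hp' : p ≤ 1) (n : ℕ) :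
    Monotone (truncatedMean M p n) := by
  induction n with
  | zero => exact fun x y hxy => min_le_min_right M (Nat.cast_le.2 hxy)
  | succ n ih =>
    exact fun x y hxy => add_le_add (mul_le_mul_of_nonneg_left (ih (Nat.succ_le_succ hxy)) hp)
      (mul_le_mul_of_nonneg_left (ih hxy) (sub_nonneg.2 hp'))

-- The parabola `y - (y - M + a) ^ 2 / (4 * a)` touches `min y M` from below at `M - a` and `M + a`,
-- and the mean of a parabola is determined by the mean `n * p` and the variance `n * p * (1 - p)`.
theorem sub_div_le_truncatedMean {a : ℝ} (ha : 0 < a) (hp : 0 ≤ p) (hp' : p ≤ 1) (n x : ℕ) :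
    x + n * p - ((x + n * p - M + a) ^ 2 + n * p * (1 - p)) / (4 * a) ≤
      truncatedMean M p n x := by
  induction n generalizing x with
  | zero =>
    simp only [truncatedMean, Nat.cast_zero, zero_mul, add_zero, le_min_iff, sub_le_self_iff]
    refine ⟨by positivity, ?_⟩
    rw [sub_le_comm, le_div_iff₀ (by positivity)]
    linarith [sq_nonneg (x - M - a)]
  | succ n ih =>
    refine le_trans (le_of_eq ?_) (add_le_add (mul_le_mul_of_nonneg_left (ih (x + 1)) hp)
      (mul_le_mul_of_nonneg_left (ih x) (sub_nonneg.2 hp')))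
    push_cast
    field_simp
    ring

theorem sub_sqrt_le_truncatedMean_floor (hM : 1 ≤ M) (hp : 0 < p) (hp' : p ≤ 1) :
    M - 1 - √M / 2 ≤ truncatedMean M p ⌊M / p⌋₊ 0 := by
  have hsqrt : 1 ≤ √M := Real.one_le_sqrt.2 hM
  have hle : ⌊M / p⌋₊ * p ≤ M := (le_div_iff₀ hp).1 (Nat.floor_le (by positivity))
  have hge : M - 1 ≤ ⌊M / p⌋₊ * p := by
    have := (div_lt_iff₀ hp).1 (Nat.lt_floor_add_one (M / p))
    linarith
  refine le_trans ?_ (sub_div_le_truncatedMean (a := √M) (by positivity) hp.le hp' _ 0)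
  set ν := ⌊M / p⌋₊ * p
  have hsq : (ν - M + √M) ^ 2 ≤ √M ^ 2 := sq_le_sq' (by linarith) (by linarith)
  have hvar : ν * (1 - p) ≤ M :=
    (mul_le_of_le_one_right (by positivity) (by linarith)).trans hle
  have hdiv : ((ν - M + √M) ^ 2 + ν * (1 - p)) / (4 * √M) ≤ √M / 2 := by
    rw [div_le_iff₀ (by positivity)]
    linarith [Real.sq_sqrt (zero_le_one.trans hM)]
  rw [Nat.cast_zero, zero_add]
  linarith

theorem Policy.truncatedMean_le_expectation_load {S : Type} {b : ℕ} (A : Policy S b)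
    {W : Finset S} {r : Request S} {p : unitInterval} (hr : ∀ s ∈ W, r s = some p)
    (hA : ∀ h, (∃ s ∈ W, matchesOf h s < b) → ∃ s ∈ W, A.choose h r = some s)
    (n : ℕ) (h : History S) (G : Instance S) :
    ENNReal.ofReal (truncatedMean (W.card * b) p n (load W h)) ≤
      A.expectation (fun h' => load W h') h (List.replicate n r ++ G) := by
  classical
  have hp := p.2.1
  have hp' := p.2.2
  induction n generalizing h with
  | zero =>
    refine A.le_expectation fun h' hh' => ENNReal.ofReal_le_natCast.2 ?_
    exact (min_le_left _ _).trans (Nat.cast_le.2 (A.load_le_of_mem_support_run W h' hh'))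
  | succ n ih =>
    rcases le_or_gt (W.card * b) (load W h) with hfull | hspare
    · refine A.le_expectation fun h' hh' => ENNReal.ofReal_le_natCast.2 ?_
      refine (truncatedMean_le hp hp' _ _).trans ?_
      exact_mod_cast hfull.trans (A.load_le_of_mem_support_run W h' hh')
    · obtain ⟨s, hs, hc⟩ := hA h (exists_matchesOf_lt_of_load_lt hspare)
      have hmatch := ih (⟨r, some (s, true)⟩ :: h)
      have hfail := ih (⟨r, some (s, false)⟩ :: h)
      rw [load_cons_true, if_pos hs] at hmatch
      rw [load_cons_false] at hfail
      have hnonneg (x : ℕ) : 0 ≤ truncatedMean (W.card * b) p n x :=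
        truncatedMean_nonneg (by positivity) hp hp' n x
      rw [List.replicate_succ, List.cons_append,
        A.expectation_cons_of_choose_eq_some _ hc (hr s hs), truncatedMean,
        ENNReal.ofReal_add (mul_nonneg hp (hnonneg _)) (mul_nonneg (sub_nonneg.2 hp') (hnonneg _)),
        ENNReal.ofReal_mul hp, ENNReal.ofReal_mul (sub_nonneg.2 hp')]
      gcongr

theorem Policy.truncatedMean_zero_le_expectation_load {S : Type} {b : ℕ} (A : Policy S b)
    {W : Finset S} {r : Request S} {p : unitInterval} (hr : ∀ s ∈ W, r s = some p)
    (hA : ∀ h, (∃ s ∈ W, matchesOf h s < b) → ∃ s ∈ W, A.choose h r = some s)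
    (n : ℕ) (h : History S) (G₁ G₂ : Instance S) :
    ENNReal.ofReal (truncatedMean (W.card * b) p n 0) ≤
      A.expectation (fun h' => load W h') h (G₁ ++ List.replicate n r ++ G₂) := by
  rw [List.append_assoc, A.expectation_append]
  refine A.le_expectation fun h' _ => ?_
  refine le_trans ?_ (A.truncatedMean_le_expectation_load hr hA n h' G₂)
  exact ENNReal.ofReal_le_ofReal (truncatedMean_monotone p.2.1 p.2.2 n (Nat.zero_le _))

end TruncatedMean

section PriorityPolicy

variable {S : Type} [Fintype S] {b : ℕ}

open Classical in
/-- The servers that a policy may assign the request `r` to. -/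
noncomputable def available (b : ℕ) (h : History S) (r : Request S) : Finset S :=
  {s | r s ≠ none ∧ matchesOf h s < b}

theorem mem_available {h : History S} {r : Request S} {s : S} :
    s ∈ available b h r ↔ r s ≠ none ∧ matchesOf h s < b := by
  simp [available]

open Classical in
/-- The greedy policy that assigns each request to an available server of maximal priority. -/
noncomputable def priorityPolicy (priority : S → ℕ) (b : ℕ) : Policy S b where
  choose h r :=
    if hne : (available b h r).Nonempty then
      some (Finset.exists_max_image (available b h r) priority hne).choose
    else none
  feasible h r s hs := by
    split_ifs at hs with hne
    obtain rfl := Option.some.inj hs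
    exact mem_available.1 (Finset.exists_max_image (available b h r) priority hne).choose_spec.1

theorem exists_priorityPolicy_choose_eq_some (priority : S → ℕ) {h : History S} {r : Request S}
    {s : S} (hs : s ∈ available b h r) :
    ∃ s' ∈ available b h r,
      priority s ≤ priority s' ∧ (priorityPolicy priority b).choose h r = some s' := by
  have hmax := (Finset.exists_max_image (available b h r) priority ⟨s, hs⟩).choose_spec
  exact ⟨_, hmax.1, hmax.2 s hs, dif_pos ⟨s, hs⟩⟩

end PriorityPolicy

section Groups

variable {S : Type} {K : Type*} [DecidableEq K] (grp : S → K)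

/-- A request that is adjacent, with success probability `p`, to the servers whose group is not
in the list `l`. -/
def requestAvoiding (p : unitInterval) (l : List K) : Request S :=
  fun s => if grp s ∈ l then none else some p

/-- The adversarial instance that drops the groups in `l` one after the other. As in `History`, the
list has its most recent entry first. Each drop is preceded by a phase of `N` equal requests that
are adjacent to the groups not dropped before; hence the head of `l` does not affect the
instance. -/
def phases (p : unitInterval) (N : ℕ) : List K → Instance S
  | [] => []
  | _ :: l => phases p N l ++ List.replicate N (requestAvoiding grp p l)

theorem length_phases (p : unitInterval) (N : ℕ) (l : List K) :
    (phases grp p N l).length = l.length * N := by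
  induction l with
  | nil => simp [phases]
  | cons g l ih => simp [phases, ih, Nat.succ_mul]

theorem requestAvoiding_of_mem (p : unitInterval) {l : List K} {s : S} (hs : grp s ∈ l) :
    requestAvoiding grp p l s = none :=
  if_pos hs

theorem phases_mem_equalProbability (p : unitInterval) (N : ℕ) (l : List K) :
    phases grp p N l ∈ equalProbability S p := by
  induction l with
  | nil => simp [phases, equalProbability]
  | cons g l ih =>
    intro r hr s q hq
    rcases List.mem_append.1 hr with hr | hr
    · exact ih r hr s q hq
    · obtain rfl := List.eq_of_mem_replicate hr
      simp only [requestAvoiding, Option.ite_none_left_eq_some, Option.some.injEq] at hq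
      exact hq.2.symm

theorem exists_phases_append_eq (p : unitInterval) (N : ℕ) (l' l : List K) :
    ∃ G, phases grp p N (l' ++ l) = phases grp p N l ++ G ∧
      ∀ r ∈ G, ∀ s, grp s ∈ l → r s = none := by
  induction l' with
  | nil => exact ⟨[], by simp⟩
  | cons g l' ih =>
    obtain ⟨G, hG, hnone⟩ := ih
    refine ⟨G ++ List.replicate N (requestAvoiding grp p (l' ++ l)), ?_, ?_⟩
    · rw [List.cons_append, phases, hG, List.append_assoc]
    · intro r hr s hs
      rcases List.mem_append.1 hr with hr | hr
      · exact hnone r hr s hs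
      · obtain rfl := List.eq_of_mem_replicate hr
        exact requestAvoiding_of_mem grp p (List.mem_append_right l' hs)

variable [Fintype S]

/-- The servers of the group `g`. -/
def members (g : K) : Finset S := {s | grp s = g}

variable {grp}

theorem mem_members {g : K} {s : S} : s ∈ members grp g ↔ grp s = g := by
  simp [members]

theorem sum_load_members [Fintype K] (h : History S) :
    ∑ g, load (members grp g) h = load Finset.univ h :=
  Finset.sum_fiberwise Finset.univ grp (matchesOf h)

end Groups

section Benchmark

variable {S : Type} {K : Type*} [Fintype S] [DecidableEq K] {grp : S → K} {b : ℕ}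

theorem eq_of_idxOf_le_idxOf {l₁ l₂ : List K} {g g' : K} (hnd : (l₁ ++ g :: l₂).Nodup)
    (hmem : g' ∈ l₁ ++ g :: l₂) (hl₂ : g' ∉ l₂)
    (hle : (l₁ ++ g :: l₂).idxOf g ≤ (l₁ ++ g :: l₂).idxOf g') : g' = g := by
  have := List.idxOf_lt_length_of_mem (a := g') (l := l₁)
  grind

theorem exists_mem_members_priorityPolicy_choose_eq_some {l₁ l₂ : List K} {g : K}
    (hnd : (l₁ ++ g :: l₂).Nodup) (hmem : ∀ g', g' ∈ l₁ ++ g :: l₂) (p : unitInterval)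
    {h : History S} (hspare : ∃ s ∈ members grp g, matchesOf h s < b) :
    ∃ s ∈ members grp g,
      (priorityPolicy (fun s => (l₁ ++ g :: l₂).idxOf (grp s)) b).choose h
        (requestAvoiding grp p l₂) = some s := by
  obtain ⟨s, hs, hlt⟩ := hspare
  have hg : g ∉ l₂ := (List.nodup_cons.1 (List.nodup_append.1 hnd).2.1).1
  have hav : s ∈ available b h (requestAvoiding grp p l₂) :=
    mem_available.2 ⟨by simp [requestAvoiding, mem_members.1 hs, hg], hlt⟩
  obtain ⟨s', hs', hle, hc⟩ := exists_priorityPolicy_choose_eq_some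
    (fun s => (l₁ ++ g :: l₂).idxOf (grp s)) hav
  refine ⟨s', mem_members.2 (eq_of_idxOf_le_idxOf hnd (hmem _) ?_ (mem_members.1 hs ▸ hle)), hc⟩
  exact fun hmem' => (mem_available.1 hs').1 (requestAvoiding_of_mem grp p hmem')

theorem card_mul_truncatedMean_le_SOpt [Fintype K] {m : ℕ}
    (hm : ∀ g, (members grp g).card = m) (p : unitInterval) (N : ℕ) {l : List K} (hnd : l.Nodup)
    (hmem : ∀ g, g ∈ l) :
    ENNReal.ofReal (Fintype.card K * truncatedMean (m * b) p N 0) ≤ SOpt b (phases grp p N l) := by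
  refine le_iSup_of_le (priorityPolicy (fun s => l.idxOf (grp s)) b) ?_
  set A := priorityPolicy (fun s => l.idxOf (grp s)) b
  have hgroup (g : K) : ENNReal.ofReal (truncatedMean (m * b) p N 0) ≤
      A.expectation (fun h => load (members grp g) h) [] (phases grp p N l) := by
    obtain ⟨l₁, l₂, rfl⟩ := List.append_of_mem (hmem g)
    have hg : g ∉ l₂ := (List.nodup_cons.1 (List.nodup_append.1 hnd).2.1).1
    obtain ⟨G, hG, -⟩ := exists_phases_append_eq grp p N l₁ (g :: l₂)
    rw [hG, phases, ← hm g]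
    exact A.truncatedMean_zero_le_expectation_load
      (fun s hs => if_neg (mem_members.1 hs ▸ hg))
      (fun h => exists_mem_members_priorityPolicy_choose_eq_some hnd hmem p) N [] _ G
  calc
    ENNReal.ofReal (Fintype.card K * truncatedMean (m * b) p N 0)
      = ∑ _g : K, ENNReal.ofReal (truncatedMean (m * b) p N 0) := by
        simp [ENNReal.ofReal_mul]
    _ ≤ ∑ g, A.expectation (fun h => load (members grp g) h) [] (phases grp p N l) :=
        Finset.sum_le_sum fun g _ => hgroup g
    _ = A.expectedMatches (phases grp p N l) := by
        rw [← A.expectation_sum]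
        simp only [← Nat.cast_sum, sum_load_members]
        rfl

end Benchmark

section Adversary

variable {S : Type} {K : Type*} [Fintype S] [DecidableEq K] {grp : S → K} {b : ℕ}
  (A : RandomizedAlgorithm.{u} S b) {p : unitInterval} {N : ℕ}

theorem RandomizedAlgorithm.sum_meanLoad_phases_append (l' l : List K) :
    ∑ g ∈ l.toFinset, A.meanLoad (members grp g) (phases grp p N (l' ++ l)) =
      ∑ g ∈ l.toFinset, A.meanLoad (members grp g) (phases grp p N l) := by
  refine Finset.sum_congr rfl fun g hg => ?_
  obtain ⟨G, hG, hnone⟩ := exists_phases_append_eq grp p N l' l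
  rw [hG]
  exact A.meanLoad_append_of_not_adjacent _ fun r hr s hs =>
    hnone r hr s (mem_members.1 hs ▸ List.mem_toFinset.1 hg)

variable [Fintype K] {M : ℝ}

theorem RandomizedAlgorithm.sum_meanLoad_phases_le (hN : N * (p : ℝ) ≤ M) (l : List K) :
    ∑ g, A.meanLoad (members grp g) (phases grp p N l) ≤ l.length * M := by
  rw [A.sum_meanLoad_of_sum_load sum_load_members]
  refine (A.meanLoad_le_length_mul _ (phases_mem_equalProbability grp p N l)).trans ?_
  rw [length_phases, Nat.cast_mul, mul_assoc]
  gcongr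

-- The next phase does not depend on the group `g` dropped after it, so the adversary can pick the
-- group with the smallest mean load after that phase.
theorem RandomizedAlgorithm.exists_cons_sum_meanLoad_le (hN : N * (p : ℝ) ≤ M) {l : List K}
    {s : ℕ} (hs : (l.toFinset)ᶜ.card = s + 1) :
    ∃ g ∉ l, (s + 1) * ∑ g' ∈ (g :: l).toFinset,
        A.meanLoad (members grp g') (phases grp p N (g :: l)) ≤
      s * ∑ g' ∈ l.toFinset, A.meanLoad (members grp g') (phases grp p N l) +
        (l.length + 1) * M := by
  have hne : (l.toFinset)ᶜ.Nonempty := Finset.card_pos.1 (by omega)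
  have ⟨g₀, _⟩ := hne
  set X : K → ℝ := fun g => A.meanLoad (members grp g) (phases grp p N (g₀ :: l))
  obtain ⟨g, hg, hmin⟩ := Finset.exists_min_image _ X hne
  have hcompl : (s + 1) * X g ≤ ∑ g' ∈ (l.toFinset)ᶜ, X g' := by
    simpa [hs] using Finset.card_nsmul_le_sum _ X (X g) hmin
  have htotal : ∑ g', X g' ≤ (l.length + 1) * M := by
    simpa using A.sum_meanLoad_phases_le hN (g₀ :: l)
  have hdropped : ∑ g' ∈ l.toFinset, X g' =
      ∑ g' ∈ l.toFinset, A.meanLoad (members grp g') (phases grp p N l) :=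
    A.sum_meanLoad_phases_append [g₀] l
  have hgl : g ∉ l.toFinset := Finset.mem_compl.1 hg
  refine ⟨g, by simpa using hgl, ?_⟩
  rw [List.toFinset_cons, Finset.sum_insert hgl]
  change (s + 1) * (X g + ∑ g' ∈ l.toFinset, X g') ≤ _
  rw [← hdropped]
  linarith [Finset.sum_add_sum_compl l.toFinset X]

-- Let the slack be `t * M` minus the mean load of the `t` dropped groups. The drop that leaves `s`
-- groups turns `slack / (s + 1)` into a `slack / s` that is larger by at least `M / (s + 1)`, hence
-- the harmonic sum.
theorem RandomizedAlgorithm.exists_sum_meanLoad_dropped_le (hN : N * (p : ℝ) ≤ M) (t s : ℕ)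
    (hts : t + s = Fintype.card K) :
    ∃ l : List K, l.Nodup ∧ l.length = t ∧
      ∑ g ∈ l.toFinset, A.meanLoad (members grp g) (phases grp p N l) ≤
        M * (t - s * (harmonic (t + s) - harmonic s)) := by
  induction t generalizing s with
  | zero => exact ⟨[], by simp⟩
  | succ t ih =>
    obtain ⟨l, hnd, hlen, hle⟩ := ih (s + 1) (by omega)
    have hs : (l.toFinset)ᶜ.card = s + 1 := by
      rw [Finset.card_compl, List.toFinset_card_of_nodup hnd]
      omega
    obtain ⟨g, hg, hstep⟩ := A.exists_cons_sum_meanLoad_le (grp := grp) hN hs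
    refine ⟨g :: l, List.nodup_cons.2 ⟨hg, hnd⟩, by simp [hlen], ?_⟩
    refine le_of_mul_le_mul_left (hstep.trans ?_) (by positivity : (0 : ℝ) < s + 1)
    calc
      _ ≤ s * (M * (t - (s + 1) * (harmonic (t + (s + 1)) - harmonic (s + 1)))) +
          (t + 1) * M := by
        rw [hlen]
        gcongr
        exact_mod_cast hle
      _ = (s + 1) * (M * ((t + 1 : ℕ) - s * (harmonic (t + 1 + s) - harmonic s))) := by
        rw [harmonic_succ s, show t + (s + 1) = t + 1 + s by ring]
        push_cast
        field_simp
        ring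

theorem RandomizedAlgorithm.exists_meanLoad_univ_le {m : ℕ} (hm : ∀ g, (members grp g).card = m)
    (hN : N * (p : ℝ) ≤ m * b) {s : ℕ} (hs : s ≤ Fintype.card K) :
    ∃ l : List K, l.Nodup ∧ (∀ g, g ∈ l) ∧ A.meanLoad Finset.univ (phases grp p N l) ≤
      m * b * (Fintype.card K - s * (harmonic (Fintype.card K) - harmonic s)) := by
  obtain ⟨t, ht⟩ := Nat.exists_eq_add_of_le' hs
  obtain ⟨l, hnd, hlen, hle⟩ := A.exists_sum_meanLoad_dropped_le (grp := grp) hN t s ht.symm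
  have hcard : (l.toFinset)ᶜ.card = s := by
    rw [Finset.card_compl, List.toFinset_card_of_nodup hnd]
    omega
  refine ⟨(l.toFinset)ᶜ.toList ++ l, ?_, ?_, ?_⟩
  · exact (Finset.nodup_toList _).append hnd fun g hg hgl => by simp_all
  · intro g
    by_cases hg : g ∈ l <;> simp [hg]
  · have hundropped : ∑ g ∈ (l.toFinset)ᶜ,
        A.meanLoad (members grp g) (phases grp p N ((l.toFinset)ᶜ.toList ++ l)) ≤ s * (m * b) := by
      rw [← hcard, ← nsmul_eq_mul]
      exact Finset.sum_le_card_nsmul _ _ _ fun g _ => hm g ▸ A.meanLoad_le_card_mul _ _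
    rw [← A.sum_meanLoad_of_sum_load (sum_load_members (grp := grp)),
      ← Finset.sum_add_sum_compl l.toFinset, A.sum_meanLoad_phases_append, ht]
    push_cast
    linarith

end Adversary

section Parameters

open Filter Topology

theorem tendsto_harmonic_sub_harmonic_floor {a : ℝ} (ha : 0 < a) :
    Tendsto (fun k : ℕ => (harmonic k - harmonic ⌊a * k⌋₊ : ℝ)) atTop (𝓝 (-Real.log a)) := by
  have hmul : Tendsto (fun k : ℕ => a * (k : ℝ)) atTop atTop :=
    tendsto_natCast_atTop_atTop.const_mul_atTop ha
  have hratio : Tendsto (fun k : ℕ => (⌊a * k⌋₊ : ℝ) / k) atTop (𝓝 a) :=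
    (tendsto_nat_floor_mul_div_atTop ha.le).comp tendsto_natCast_atTop_atTop
  have hfloor : Tendsto (fun k : ℕ => ⌊a * k⌋₊) atTop atTop := tendsto_nat_floor_atTop.comp hmul
  have hlim := (Real.tendsto_harmonic_sub_log.sub
    (Real.tendsto_harmonic_sub_log.comp hfloor)).sub (hratio.log ha.ne')
  rw [sub_self, zero_sub] at hlim
  refine hlim.congr' ?_
  filter_upwards [eventually_gt_atTop 0, hfloor.eventually_gt_atTop 0] with k hk hs
  rw [Real.log_div (by positivity) (by positivity), Function.comp_apply]
  ring

theorem exists_sub_mul_harmonic_lt {c : ℝ} (hc : 1 - 1 / Real.exp 1 < c) :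
    ∃ k s : ℕ, 0 < k ∧ s ≤ k ∧ k - s * (harmonic k - harmonic s : ℝ) < k * c := by
  set a : ℝ := (Real.exp 1)⁻¹ with ha
  have ha0 : 0 < a := by positivity
  have ha1 : a ≤ 1 := inv_le_one_of_one_le₀ (Real.one_le_exp zero_le_one)
  have hratio : Tendsto (fun k : ℕ => (⌊a * k⌋₊ : ℝ) / k) atTop (𝓝 a) :=
    (tendsto_nat_floor_mul_div_atTop ha0.le).comp tendsto_natCast_atTop_atTop
  have hlim := (hratio.mul (tendsto_harmonic_sub_harmonic_floor ha0)).const_sub 1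
  have hlt : 1 - a * -Real.log a < c := by simpa [ha, Real.log_inv] using hc
  obtain ⟨k, hk, hk0⟩ := ((hlim.eventually_lt_const hlt).and (eventually_gt_atTop 0)).exists
  refine ⟨k, ⌊a * k⌋₊, hk0, Nat.floor_le_of_le (mul_le_of_le_one_left k.cast_nonneg ha1), ?_⟩
  have hk' : (0 : ℝ) < k := Nat.cast_pos.2 hk0
  calc
    _ = k * (1 - (⌊a * k⌋₊ : ℝ) / k * (harmonic k - harmonic ⌊a * k⌋₊)) := by field_simp
    _ < k * c := mul_lt_mul_of_pos_left hk hk'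

theorem exists_mul_lt_mul_sub_sqrt {b : ℕ} (hb : 1 ≤ b) {c' c : ℝ} (hc : c' < c) :
    ∃ m : ℕ, 0 < m ∧ (m * b : ℝ) * c' < c * (m * b - 1 - √(m * b) / 2) := by
  have hM : Tendsto (fun m : ℕ => (m * b : ℝ)) atTop atTop :=
    tendsto_natCast_atTop_atTop.atTop_mul_const (Nat.cast_pos.2 hb)
  have hlim : Tendsto (fun x : ℝ => c * (1 - x⁻¹ - (√x)⁻¹ / 2)) atTop (𝓝 (c * (1 - 0 - 0 / 2))) :=
    ((tendsto_inv_atTop_zero.const_sub 1).sub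
      ((tendsto_inv_atTop_zero.comp Real.tendsto_sqrt_atTop).div_const 2)).const_mul c
  obtain ⟨m, hm, hm0⟩ := (((hlim.comp hM).eventually_const_lt (by simpa using hc)).and
    (eventually_gt_atTop 0)).exists
  have hpos : (0 : ℝ) < m * b := by positivity
  refine ⟨m, hm0, (mul_lt_mul_of_pos_left hm hpos).trans_eq ?_⟩
  have hsqrt : (m * b : ℝ) * (√(m * b))⁻¹ = √(m * b) := Real.div_sqrt
  calc
    _ = c * (m * b - m * b * (m * b : ℝ)⁻¹ - m * b * (√(m * b))⁻¹ / 2) := by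
      rw [Function.comp_apply]
      ring
    _ = _ := by rw [hsqrt, mul_inv_cancel₀ hpos.ne']

end Parameters

theorem RandomizedAlgorithm.not_isCompetitiveOn_of_card_members {S : Type} {K : Type*} [Fintype S]
    [Fintype K] [DecidableEq K] {grp : S → K} {b m : ℕ} (hm : ∀ g, (members grp g).card = m)
    (hM : 1 ≤ m * b) {s : ℕ} (hs : s ≤ Fintype.card K) {c : ℝ} (hc : 0 ≤ c)
    (hlt : m * b * (Fintype.card K - s * (harmonic (Fintype.card K) - harmonic s)) <
      Fintype.card K * (c * (m * b - 1 - √(m * b) / 2)))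
    {p : unitInterval} (hp : 0 < (p : ℝ)) (A : RandomizedAlgorithm.{u} S b) :
    ¬ A.IsCompetitiveOn c (equalProbability S p) := by
  intro hA
  set N : ℕ := ⌊(m * b : ℝ) / p⌋₊
  have hN : N * (p : ℝ) ≤ m * b := (le_div_iff₀ hp).1 (Nat.floor_le (by positivity))
  obtain ⟨l, hnd, hmem, honline⟩ := A.exists_meanLoad_univ_le hm hN hs
  have hcomp : ENNReal.ofReal (c * (Fintype.card K * truncatedMean (m * b) p N 0)) ≤
      ENNReal.ofReal (A.meanLoad Finset.univ (phases grp p N l)) := by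
    rw [ENNReal.ofReal_mul hc, A.ofReal_meanLoad_univ]
    refine le_trans ?_ (hA _ (phases_mem_equalProbability grp p N l))
    gcongr
    exact card_mul_truncatedMean_le_SOpt hm p N hnd hmem
  rw [ENNReal.ofReal_le_ofReal_iff (A.meanLoad_nonneg _ _)] at hcomp
  have hopt : Fintype.card K * (c * (m * b - 1 - √(m * b) / 2)) ≤
      c * (Fintype.card K * truncatedMean (m * b) p N 0) := by
    rw [mul_left_comm]
    gcongr
    exact sub_sqrt_le_truncatedMean_floor (by exact_mod_cast hM) hp p.2.2
  exact absurd (hopt.trans (hcomp.trans honline)) hlt.not_ge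

theorem card_members_finProdFinEquiv_symm_fst {k m : ℕ} (g : Fin k) :
    (members (fun s : Fin (k * m) => (finProdFinEquiv.symm s).1) g).card = m := by
  rw [members, Finset.card_filter, ← finProdFinEquiv.sum_comp, Fintype.sum_prod_type]
  simp

end StochasticBMatching

open StochasticBMatching in
theorem mainTheorem1_general (b : ℕ) (hb : 1 ≤ b) (c : ℝ) (hc : 1 - 1 / Real.exp 1 < c) :
    ∃ n : ℕ, ∀ p : unitInterval, 0 < (p : ℝ) →
      ∀ A : RandomizedAlgorithm.{u} (Fin n) b,
        ¬ A.IsCompetitiveOn c (equalProbability (Fin n) p) := by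
  obtain ⟨k, s, hk, hsk, hlt⟩ := exists_sub_mul_harmonic_lt hc
  have hk' : (0 : ℝ) < k := Nat.cast_pos.2 hk
  obtain ⟨m, hm, hmc⟩ := exists_mul_lt_mul_sub_sqrt hb ((div_lt_iff₀' hk').2 hlt)
  have hc0 : 0 ≤ c := by
    refine le_trans (sub_nonneg.2 ?_) hc.le
    exact div_le_one_of_le₀ (Real.one_le_exp zero_le_one) (Real.exp_pos 1).le
  refine ⟨k * m, fun p hp A => A.not_isCompetitiveOn_of_card_members
    card_members_finProdFinEquiv_symm_fst (Nat.mul_pos hm hb) (by simpa using hsk) hc0 ?_ hp⟩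
  rw [Fintype.card_fin, ← div_lt_iff₀' hk', mul_div_assoc]
  exact hmc

open StochasticBMatching in
/-- For every capacity `b ≥ 1` and every `c > 1 - 1/e` there is a number `n` of servers such that,
for all sufficiently small `p > 0`, no randomized online algorithm, even one tailored to `n`, `b`
and `p`, is `c`-competitive against the stochastic benchmark on the graphs with `n` servers and all
edge probabilities equal to `p`. -/
theorem mainTheorem1 (b : ℕ) (hb : 1 ≤ b) (c : ℝ) (hc : 1 - 1 / Real.exp 1 < c) :
    ∃ n : ℕ, ∃ p₀ : ℝ, 0 < p₀ ∧
      ∀ p : unitInterval, 0 < (p : ℝ) → (p : ℝ) ≤ p₀ →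
        ∀ A : RandomizedAlgorithm.{u} (Fin n) b,
          ¬ A.IsCompetitiveOn c (equalProbability (Fin n) p) := by
  obtain ⟨n, hn⟩ := mainTheorem1_general b hb c hc
  exact ⟨n, 1, one_pos, fun p hp _ => hn p hp⟩
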